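/- **Theorem 1.** Write $N = 2^n$. A $k$-parallel quantum algorithm with oracle $f : \{0,1\}^n \to \{0,1\}$ draws a uniformly random seed from a finite set and then uses $k$ quantum processors side by side. In each of finitely many rounds, every processor prepares $|0\cdots0\rangle$, executes a quantum circuit that depends on the seed, and measures all of its qubits; the output in $\{0,1\}^n$ is a function of the seed and of all measured strings. One time step of a circuit is either one layer of arbitrary one-qubit unitaries, or one multiply controlled $Z$ gate, or one oracle query $|x\rangle|b\rangle \mapsto |x\rangle|b \oplus f(x)\rangle$. The sequential time is the largest number of time steps of a processor (each round counts one further step for preparation and measurement), in the worst case over the seed; the number of oracle queries is the total over all processors, in the worst case over the seed. There exist an absolute constant $C > 0$ and, for all integers $n \ge 0$ and $k, M \ge 1$, a $k$-parallel quantum algorithm $A_{n,k,M}$ with oracle $\{0,1\}^n \to \{0,1\}$, such that whenever $kM \le N$ the following holds. If $S$ is a uniformly random subset of $\{0,1\}^n$ with $M$ elements and $f_S$ is its indicator function, then $$\Pr\left[A_{n,k,M}^{f_S} \in S\right] > \frac12,$$ where the probability is over the choice of $S$ and the randomness of the algorithm (seed and measurements); moreover, the sequential time of $A_{n,k,M}$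 is at most $C\sqrt{N/(kM)}$, and it makes at most $C\sqrt{kN/M}$ oracle queries in total. -/

import Mathlib

open scoped BigOperators

namespace ParallelQuantum

/-- Bit strings of length `n`, that is, the elements of `{0,1}^n`. -/
abbrev BitString (n : ℕ) : Type := Fin n → Bool

/-- Vectors of amplitudes of `w` qubits in the computational basis. -/
abbrev QState (w : ℕ) : Type := BitString w → ℂ

/-- One time step of a quantum circuit on `w` qubits that has access to an oracle
`{0,1}^n → {0,1}`:
* `oneQubit u` applies, simultaneously, the one-qubit unitary `u i` to every qubit `i`;
* `phase s` is a multiply controlled `Z` gate: it negates the amplitude of every basis state in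
  which all qubits of `s` are `1`;
* `query inp tgt` is one oracle query: the `n` qubits listed by `inp` hold the argument and the
  answer is added modulo 2 to the qubit `tgt`, which is not one of them. -/
inductive Layer (n w : ℕ) : Type
  | oneQubit (u : Fin w → Matrix.unitaryGroup Bool ℂ) : Layer n w
  | phase (s : Finset (Fin w)) : Layer n w
  | query (inp : Fin n ↪ Fin w) (tgt : Fin w) (htgt : ∀ i, inp i ≠ tgt) : Layer n w

/-- The action of a layer on a state, when the oracle is `f`. -/
noncomputable def Layer.apply {n w : ℕ} (f : BitString n → Bool) :
    Layer n w → QState w → QState w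
  | .oneQubit u, ψ => fun x =>
      ∑ y : BitString w, (∏ i, (u i : Matrix Bool Bool ℂ) (x i) (y i)) * ψ y
  | .phase s, ψ => fun x => (if ∀ i ∈ s, x i = true then -1 else 1) * ψ x
  | .query inp tgt _, ψ => fun x =>
      ψ (Function.update x tgt (xor (x tgt) (f fun i => x (inp i))))

/-- The number of oracle queries that a layer makes. -/
def Layer.queries {n w : ℕ} : Layer n w → ℕ
  | .oneQubit _ => 0
  | .phase _ => 0
  | .query _ _ _ => 1

/-- A quantum circuit with oracle gates, as the list of its layers in order of execution. -/
abbrev Circuit (n w : ℕ) : Type := List (Layer n w)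

/-- The final state of a circuit that is started in `|0…0⟩`. -/
noncomputable def Circuit.run {n w : ℕ} (f : BitString n → Bool) (c : Circuit n w) : QState w :=
  c.foldl (fun ψ l => l.apply f ψ) (Pi.single (fun _ => false) 1)

/-- The Born rule: the probability that measuring all qubits at the end of the circuit
yields `x`. -/
noncomputable def Circuit.outcomeProb {n w : ℕ} (f : BitString n → Bool) (c : Circuit n w)
    (x : BitString w) : ℝ :=
  ‖Circuit.run f c x‖ ^ 2

/-- The number of oracle queries of a circuit. -/
def Circuit.queries {n w : ℕ} (c : Circuit n w) : ℕ :=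
  (c.map Layer.queries).sum

/-- A `k`-parallel quantum algorithm with an oracle `{0,1}^n → {0,1}` and an output in `{0,1}^n`.
It draws a uniformly random seed. Then each of `k` quantum processors, working side by side,
goes through `rounds` rounds; in each round it prepares `|0…0⟩`, executes one circuit, and measures
all of its qubits. The output is computed from the seed and from all measured strings, without
further access to the oracle. -/
structure ParallelAlgorithm (n k : ℕ) where
  /-- the finite set from which the classical randomness is drawn uniformly -/
  Seed : Type
  [fintypeSeed : Fintype Seed]
  [nonemptySeed : Nonempty Seed]
  /-- the number of qubits of each processor -/
  width : ℕ
  /-- the number of rounds -/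
  rounds : ℕ
  /-- the circuit that a processor executes in a round -/
  circuit : Seed → Fin k → Fin rounds → Circuit n width
  /-- the output as a function of the measured strings -/
  output : Seed → (Fin k → Fin rounds → BitString width) → BitString n

attribute [instance] ParallelAlgorithm.fintypeSeed ParallelAlgorithm.nonemptySeed

namespace ParallelAlgorithm

variable {n k : ℕ}

/-- The sequential running time in the worst case: the largest number of time steps of a processor.
Every layer of a circuit counts as one step, and so do, in each round, preparation and
measurement together. -/
noncomputable def seqTime (A : ParallelAlgorithm n k) : ℕ :=
  Finset.univ.sup fun ω : A.Seed =>
    Finset.univ.sup fun j : Fin k => ∑ r : Fin A.rounds, ((A.circuit ω j r).length + 1)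

/-- The total number of oracle queries of all processors together, in the worst case. -/
noncomputable def totalQueries (A : ParallelAlgorithm n k) : ℕ :=
  Finset.univ.sup fun ω : A.Seed =>
    ∑ j : Fin k, ∑ r : Fin A.rounds, Circuit.queries (A.circuit ω j r)

/-- The probability that the output lies in `S` when the oracle is the indicator function of `S`. -/
noncomputable def successProb (A : ParallelAlgorithm n k) (S : Finset (BitString n)) : ℝ :=
  (∑ ω : A.Seed, ∑ m : Fin k → Fin A.rounds → BitString A.width,
      if A.output ω m ∈ S then
        ∏ j : Fin k, ∏ r : Fin A.rounds,
          Circuit.outcomeProb (fun x => decide (x ∈ S)) (A.circuit ω j r) (m j r)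
      else 0) / Fintype.card A.Seed

/-- The success probability when, in addition, `S` is a uniformly random set of `M` elements
of `{0,1}^n`. -/
noncomputable def avgSuccessProb (A : ParallelAlgorithm n k) (M : ℕ) : ℝ :=
  (∑ S ∈ Finset.powersetCard M (Finset.univ : Finset (BitString n)), A.successProb S) /
    (Finset.powersetCard M (Finset.univ : Finset (BitString n))).card

end ParallelAlgorithm

end ParallelQuantum

namespace ParallelQuantum

open Finset

/-! Every processor runs Grover search on the whole space, but stops after about `√(N/(kM))/4`
iterations instead of order `√(N/M)`. With `sin² θ = M/N`, a run ends in a marked string with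
probability `sin² ((2t+1)θ)`. The stopping time keeps the angle between `1/(4√k)` and `π/2`, so
Jordan's inequality makes this at least `1/(40k)` (`one_div_le_sin_sq`).

A last query writes membership into the ancilla, so a run knows whether it succeeded
(`run_groverCircuit`). Hence `k` processors and 40 rounds are `40k` independent verified trials. All
of them fail with probability at most `(1 - 1/(40k))^(40k) ≤ 1/e < 1/2`
(`le_successProb_parallelGrover`, `one_sub_pow_lt_half`). The bound holds for each `S` of size `M`,
hence on average. -/

/-! ### Circuits on `n + 1` qubits whose qubit `0` is an ancilla -/

/-- The state `|0⟩ ⊗ a` on `n + 1` qubits, where the ancilla is the qubit `0`. -/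
def liftState {n : ℕ} (a : QState n) : QState (n + 1) :=
  fun x => if x 0 = true then 0 else a (Fin.tail x)

/-- The action of `u ⊗ ⋯ ⊗ u` on a state. -/
noncomputable def tensorApply {n : ℕ} (u : Matrix.unitaryGroup Bool ℂ) (a : QState n) :
    QState n :=
  fun x => ∑ y : BitString n, (∏ i, (u : Matrix Bool Bool ℂ) (x i) (y i)) * a y

lemma sum_bitString_succ {n : ℕ} {E : Type*} [AddCommMonoid E] (g : BitString (n + 1) → E) :
    ∑ x, g x = ∑ b : Bool, ∑ z : BitString n, g (Fin.cons b z) := by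
  rw [← Fintype.sum_prod_type']
  exact (Equiv.sum_comp (Fin.consEquiv fun _ : Fin (n + 1) => Bool) g).symm

/-- The layer that applies `u` to every qubit except the ancilla. -/
def inputLayer (n : ℕ) (u : Matrix.unitaryGroup Bool ℂ) : Layer n (n + 1) :=
  .oneQubit (Fin.cons 1 fun _ => u)

/-- The query whose answer goes to the ancilla. -/
def ancillaQuery (n : ℕ) : Layer n (n + 1) :=
  .query (Fin.succEmb n) 0 fun i => Fin.succ_ne_zero i

lemma inputLayer_apply_liftState {n : ℕ} (f : BitString n → Bool)
    (u : Matrix.unitaryGroup Bool ℂ) (a : QState n) :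
    (inputLayer n u).apply f (liftState a) = liftState (tensorApply u a) := by
  funext x
  simp only [inputLayer, Layer.apply, sum_bitString_succ, Fin.prod_univ_succ, liftState,
    tensorApply, Fin.cons_zero, Fin.cons_succ, Fintype.sum_bool, Fin.tail_cons]
  cases h : x 0 <;> simp [Fin.tail]

/-- Negate the amplitude of `|1…1⟩`. -/
noncomputable def negOnes {n : ℕ} (a : QState n) : QState n :=
  fun x => (if ∀ i, x i = true then -1 else 1) * a x

lemma phase_apply_liftState {n : ℕ} (f : BitString n → Bool) (a : QState n) :
    (Layer.phase (univ.map (Fin.succEmb n))).apply f (liftState a) = liftState (negOnes a) := by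
  funext x
  by_cases hx : ∀ i : Fin n, x i.succ = true <;>
    simp [Layer.apply, liftState, negOnes, Fin.tail, Fin.forall_fin_succ, hx]

/-- The state `∑ a x |f x⟩|x⟩`. -/
def answerState {n : ℕ} (f : BitString n → Bool) (a : QState n) : QState (n + 1) :=
  fun x => if x 0 = f (Fin.tail x) then a (Fin.tail x) else 0

lemma ancillaQuery_apply_liftState {n : ℕ} (f : BitString n → Bool) (a : QState n) :
    (ancillaQuery n).apply f (liftState a) = answerState f a := by
  funext x
  have ht : (fun i => x (Fin.succEmb n i)) = Fin.tail x := rfl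
  have hu (b : Bool) : Fin.tail (Function.update x 0 b) = Fin.tail x := Fin.tail_update_zero x b
  simp only [ancillaQuery, Layer.apply, liftState, answerState, ht, hu, Function.update_self]
  cases x 0 <;> cases f (Fin.tail x) <;> simp

/-- Compute, phase, uncompute: `Z` on the ancilla turns the stored answer into a sign, and the
second query resets the ancilla to `0`. -/
lemma oracle_sign_apply {n : ℕ} (f : BitString n → Bool) (a : QState n) :
    (ancillaQuery n).apply f ((Layer.phase {0}).apply f
      ((ancillaQuery n).apply f (liftState a))) =
      liftState fun x => if f x = true then -a x else a x := by
  rw [ancillaQuery_apply_liftState]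
  funext x
  have ht : (fun i => x (Fin.succEmb n i)) = Fin.tail x := rfl
  have hu (b : Bool) : Fin.tail (Function.update x 0 b) = Fin.tail x := Fin.tail_update_zero x b
  simp only [ancillaQuery, Layer.apply, liftState, answerState, ht, hu, Function.update_self,
    mem_singleton, forall_eq]
  cases x 0 <;> cases f (Fin.tail x) <;> simp

/-! ### Reflection about the uniform superposition -/

lemma tensorApply_inv_tensorApply {n : ℕ} (u : Matrix.unitaryGroup Bool ℂ) (a : QState n) :
    tensorApply u⁻¹ (tensorApply u a) = a := by
  funext x
  have hu (b c : Bool) : ∑ d, ((u⁻¹ : Matrix.unitaryGroup Bool ℂ) : Matrix Bool Bool ℂ) b d *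
      (u : Matrix Bool Bool ℂ) d c = if b = c then 1 else 0 := by
    rw [← Matrix.mul_apply, ← Submonoid.coe_mul, inv_mul_cancel, Submonoid.coe_one,
      Matrix.one_apply]
  simp only [tensorApply, mul_sum]
  rw [sum_comm]
  have key (z : BitString n) :
      ∑ y : BitString n,
        (∏ i, ((u⁻¹ : Matrix.unitaryGroup Bool ℂ) : Matrix Bool Bool ℂ) (x i) (y i)) *
        ((∏ i, (u : Matrix Bool Bool ℂ) (y i) (z i)) * a z) = if x = z then a z else 0 := by
    have h := Fintype.prod_sum (fun (i : Fin n) (d : Bool) =>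
      ((u⁻¹ : Matrix.unitaryGroup Bool ℂ) : Matrix Bool Bool ℂ) (x i) d *
      (u : Matrix Bool Bool ℂ) d (z i))
    simp only [hu, prod_mul_distrib] at h
    simp only [← mul_assoc, ← sum_mul]
    rw [← h, Fintype.prod_ite_zero]
    simp [funext_iff]
  rw [sum_congr rfl fun z _ => key z]
  simp

/-- The rotation by `π / 4`. -/
noncomputable def rotation : Matrix.unitaryGroup Bool ℂ :=
  ⟨Matrix.of fun b c => if b = false ∧ c = true then -((√2 : ℝ) : ℂ)⁻¹ else ((√2 : ℝ) : ℂ)⁻¹, by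
    have h : ((√2 : ℝ) : ℂ)⁻¹ * ((√2 : ℝ) : ℂ)⁻¹ = 1 / 2 := by
      rw [← mul_inv, ← Complex.ofReal_mul, Real.mul_self_sqrt (by norm_num)]
      norm_num
    rw [Matrix.mem_unitaryGroup_iff]
    ext b c
    cases b <;> cases c <;> norm_num [Matrix.mul_apply, Matrix.star_apply, h]⟩

lemma rotation_true (b : Bool) : (rotation : Matrix Bool Bool ℂ) true b = ((√2 : ℝ) : ℂ)⁻¹ := by
  simp [rotation]

lemma rotation_false (b : Bool) : (rotation : Matrix Bool Bool ℂ) b false = ((√2 : ℝ) : ℂ)⁻¹ := by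
  simp [rotation]

lemma rotation_inv_true (b : Bool) :
    ((rotation⁻¹ : Matrix.unitaryGroup Bool ℂ) : Matrix Bool Bool ℂ) b true =
      ((√2 : ℝ) : ℂ)⁻¹ := by
  rw [Matrix.UnitaryGroup.inv_apply, Matrix.star_apply, rotation_true]
  simp

lemma sqrt_two_inv_pow_mul_self (n : ℕ) :
    (((√2 : ℝ) : ℂ)⁻¹) ^ n * (((√2 : ℝ) : ℂ)⁻¹) ^ n = ((2 : ℂ) ^ n)⁻¹ := by
  rw [← mul_pow, ← mul_inv, ← Complex.ofReal_mul, Real.mul_self_sqrt (by norm_num)]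
  simp

lemma tensorApply_rotation_zero (n : ℕ) :
    tensorApply rotation (Pi.single (fun _ => false) 1 : QState n) =
      fun _ => (((√2 : ℝ) : ℂ)⁻¹) ^ n := by
  funext x
  simp only [tensorApply]
  rw [Fintype.sum_eq_single (fun _ => false) (fun y hy => by simp [Pi.single_eq_of_ne hy])]
  simp [rotation_false]

lemma tensorApply_sub_single {n : ℕ} (u : Matrix.unitaryGroup Bool ℂ) (a : QState n)
    (y : BitString n) (c : ℂ) (x : BitString n) :
    tensorApply u (a - Pi.single y c) x =
      tensorApply u a x - (∏ i, (u : Matrix Bool Bool ℂ) (x i) (y i)) * c := by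
  simp only [tensorApply, Pi.sub_apply, mul_sub, sum_sub_distrib]
  rw [Fintype.sum_eq_single (f := fun z => _ * (Pi.single y c : QState n) z) y
    (fun z hz => by simp [Pi.single_eq_of_ne hz])]
  simp

/-- `negOnes` is the identity minus twice the projection onto `|1…1⟩`, and the inverse rotation
sends `|1⟩` to the uniform qubit state. The rotation itself does the same to `|0⟩`, so one gate
serves for preparation and reflection. The result is minus the usual diffusion operator. -/
lemma reflection_uniform {n : ℕ} (a : QState n) (x : BitString n) :
    tensorApply rotation⁻¹ (negOnes (tensorApply rotation a)) x =
      a x - 2 * ((2 : ℂ) ^ n)⁻¹ * ∑ y, a y := by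
  have h : negOnes (tensorApply rotation a) = tensorApply rotation a -
      Pi.single (fun _ => true) (2 * tensorApply rotation a fun _ => true) := by
    funext y
    by_cases hy : y = fun _ => true
    · subst hy
      simp [negOnes]
      ring
    · have : ¬ ∀ i, y i = true := fun h => hy (funext h)
      simp [negOnes, Pi.single_eq_of_ne hy, this]
  rw [h, tensorApply_sub_single, tensorApply_inv_tensorApply]
  simp only [tensorApply, rotation_true, rotation_inv_true, prod_const, card_univ,
    Fintype.card_fin, ← mul_sum]
  rw [← sqrt_two_inv_pow_mul_self]
  ring

/-! ### Grover's circuit -/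

/-- One Grover iteration. -/
noncomputable def groverStep (n : ℕ) : Circuit n (n + 1) :=
  [ancillaQuery n, .phase {0}, ancillaQuery n, inputLayer n rotation,
    .phase (univ.map (Fin.succEmb n)), inputLayer n rotation⁻¹]

/-- `t` Grover iterations and a query that verifies the result. -/
noncomputable def groverCircuit (n t : ℕ) : Circuit n (n + 1) :=
  inputLayer n rotation :: ((List.replicate t (groverStep n)).flatten ++ [ancillaQuery n])

lemma length_groverCircuit (n t : ℕ) : (groverCircuit n t).length = 6 * t + 2 := by
  simp [groverCircuit, groverStep]
  ring

/-- The amplitudes of the marked and of the unmarked strings after `t` Grover iterations, up to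
normalisation, when a fraction `p` of the strings is marked. -/
noncomputable def groverAmp (p : ℝ) : ℕ → ℝ × ℝ
  | 0 => (1, 1)
  | t + 1 =>
    let a := groverAmp p t
    (-a.1 - 2 * (-(p * a.1) + (1 - p) * a.2), a.2 - 2 * (-(p * a.1) + (1 - p) * a.2))

/-- Each iteration rotates by `2θ` and flips the global sign. The factors `sin θ` and `cos θ` stay
on the left because they may vanish, as `cos θ` does when every string is marked. -/
lemma groverAmp_closed_form (θ : ℝ) (t : ℕ) :
    (groverAmp (Real.sin θ ^ 2) t).1 * Real.sin θ = (-1) ^ t * Real.sin ((2 * t + 1) * θ) ∧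
    (groverAmp (Real.sin θ ^ 2) t).2 * Real.cos θ = (-1) ^ t * Real.cos ((2 * t + 1) * θ) := by
  induction t with
  | zero => simp [groverAmp]
  | succ t ih =>
    obtain ⟨h1, h2⟩ := ih
    have e : (2 * ((t + 1 : ℕ) : ℝ) + 1) * θ = (2 * t + 1) * θ + 2 * θ := by push_cast; ring
    rw [e, Real.sin_add, Real.cos_add, Real.cos_two_mul, Real.sin_two_mul]
    have hc : Real.sin θ ^ 2 = 1 - Real.cos θ ^ 2 := Real.sin_sq θ
    simp only [groverAmp]
    set α := (groverAmp (Real.sin θ ^ 2) t).1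
    set β := (groverAmp (Real.sin θ ^ 2) t).2
    constructor
    · linear_combination (-1 + 2 * Real.sin θ ^ 2) * h1 - 2 * Real.sin θ * Real.cos θ * h2 +
        2 * (-1) ^ t * Real.sin ((2 * t + 1) * θ) * hc +
        2 * β * Real.sin θ * hc
    · linear_combination (1 - 2 * Real.cos θ ^ 2) * h2 + 2 * Real.sin θ * Real.cos θ * h1 +
        2 * β * Real.cos θ * hc

/-- The state with amplitude `α` on `S` and `β` off `S`, divided by `√(2 ^ n)`. -/
noncomputable def twoValued {n : ℕ} (S : Finset (BitString n)) (a : ℝ × ℝ) : QState n :=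
  fun x => (((√2 : ℝ) : ℂ)⁻¹) ^ n * ((if x ∈ S then a.1 else a.2 : ℝ) : ℂ)

lemma sum_ite_mem_eq {n : ℕ} {R : Type*} [Ring R] (S : Finset (BitString n)) (a b : R) :
    ∑ x, (if x ∈ S then a else b) = #S * a + ((2 : R) ^ n - #S) * b := by
  have h : #(univ.filter fun x : BitString n => x ∉ S) = 2 ^ n - #S := by
    rw [filter_not, filter_mem_eq_inter, univ_inter, ← compl_eq_univ_sdiff, card_compl]
    simp
  have hle : #S ≤ 2 ^ n := by simpa using card_le_univ S
  rw [sum_ite, sum_const, sum_const, h, filter_mem_eq_inter, univ_inter, nsmul_eq_mul,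
    nsmul_eq_mul, Nat.cast_sub hle]
  simp

/-- The sign flip and the reflection, which depends on the state only through its sum, preserve the
plane of states that are constant on `S` and off `S`. -/
lemma groverStep_twoValued {n : ℕ} (S : Finset (BitString n)) (t : ℕ) :
    (groverStep n).foldl (fun ψ l => l.apply (fun x => decide (x ∈ S)) ψ)
      (liftState (twoValued S (groverAmp (#S / 2 ^ n) t))) =
      liftState (twoValued S (groverAmp (#S / 2 ^ n) (t + 1))) := by
  simp only [groverStep, List.foldl_cons, List.foldl_nil]
  rw [oracle_sign_apply, inputLayer_apply_liftState, phase_apply_liftState,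
    inputLayer_apply_liftState]
  congr 1
  funext x
  rw [reflection_uniform]
  set a := groverAmp (#S / 2 ^ n) t with ha
  have hsum : ∑ y, (if decide (y ∈ S) = true then -twoValued S a y else twoValued S a y) =
      (((√2 : ℝ) : ℂ)⁻¹) ^ n * (#S * (-a.1 : ℂ) + ((2 : ℂ) ^ n - #S) * a.2) := by
    rw [← sum_ite_mem_eq, mul_sum]
    refine sum_congr rfl fun y _ => ?_
    by_cases hy : y ∈ S <;> simp [twoValued, hy]
  have h2 : (2 : ℂ) ^ n ≠ 0 := pow_ne_zero n two_ne_zero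
  rw [hsum]
  by_cases hx : x ∈ S
  · simp [twoValued, hx, groverAmp, ← ha]
    field_simp
  · simp [twoValued, hx, groverAmp, ← ha]
    field_simp

lemma run_groverCircuit {n : ℕ} (S : Finset (BitString n)) (t : ℕ) :
    Circuit.run (fun x => decide (x ∈ S)) (groverCircuit n t) =
      answerState (fun x => decide (x ∈ S)) (twoValued S (groverAmp (#S / 2 ^ n) t)) := by
  have h0 : (Pi.single (fun _ => false) 1 : QState (n + 1)) =
      liftState (Pi.single (fun _ => false) 1) := by
    funext x
    rw [← Fin.cons_self_tail x]
    generalize Fin.tail x = z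
    have hs : (fun _ => false : BitString (n + 1)) = Fin.cons false fun _ => false := by
      funext i; refine Fin.cases rfl (fun _ => rfl) i
    cases x 0 <;> simp [liftState, Pi.single_apply, hs, Fin.cons_inj]
  have hrep (t : ℕ) : (List.replicate t (groverStep n)).flatten.foldl
      (fun ψ l => l.apply (fun x => decide (x ∈ S)) ψ)
      (liftState (twoValued S (groverAmp (#S / 2 ^ n) 0))) =
      liftState (twoValued S (groverAmp (#S / 2 ^ n) t)) := by
    induction t with
    | zero => simp
    | succ t ih =>
      rw [List.replicate_succ', List.flatten_append, List.foldl_append, ih]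
      simpa using groverStep_twoValued S t
  have hinit : (fun _ => (((√2 : ℝ) : ℂ)⁻¹) ^ n) = twoValued S (groverAmp (#S / 2 ^ n) 0) := by
    funext x
    simp [twoValued, groverAmp]
  rw [Circuit.run, groverCircuit, List.foldl_cons, h0, inputLayer_apply_liftState,
    tensorApply_rotation_zero, hinit, List.foldl_append, hrep]
  simpa using ancillaQuery_apply_liftState _ _

/-! ### Outcome probabilities of Grover's circuit -/

lemma norm_sq_twoValued {n : ℕ} (S : Finset (BitString n)) (a : ℝ × ℝ) (x : BitString n) :
    ‖twoValued S a x‖ ^ 2 = if x ∈ S then a.1 ^ 2 / 2 ^ n else a.2 ^ 2 / 2 ^ n := by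
  have h2 : (((√2 : ℝ)⁻¹) ^ n) ^ 2 = ((2 : ℝ) ^ n)⁻¹ := by
    rw [← pow_mul, mul_comm, pow_mul, inv_pow, Real.sq_sqrt (by norm_num), inv_pow]
  have h1 : ‖twoValued S a x‖ ^ 2 =
      (((√2 : ℝ)⁻¹) ^ n) ^ 2 * (if x ∈ S then a.1 else a.2) ^ 2 := by
    simp only [twoValued, norm_mul, norm_pow, norm_inv, Complex.norm_real, mul_pow,
      Real.norm_eq_abs, sq_abs, abs_of_nonneg (Real.sqrt_nonneg 2)]
  rw [h1, h2]
  split_ifs <;> ring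

lemma outcomeProb_groverCircuit {n : ℕ} (S : Finset (BitString n)) (t : ℕ) (b : Bool)
    (z : BitString n) :
    Circuit.outcomeProb (fun x => decide (x ∈ S)) (groverCircuit n t) (Fin.cons b z) =
      if b = decide (z ∈ S) then
        ‖twoValued S (groverAmp (#S / 2 ^ n) t) z‖ ^ 2 else 0 := by
  rw [Circuit.outcomeProb, run_groverCircuit]
  simp only [answerState, Fin.cons_zero, Fin.tail_cons]
  split_ifs <;> simp

lemma mem_of_outcomeProb_ne_zero {n : ℕ} {S : Finset (BitString n)} {t : ℕ}
    {x : BitString (n + 1)}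
    (h : Circuit.outcomeProb (fun x => decide (x ∈ S)) (groverCircuit n t) x ≠ 0)
    (hx : x 0 = true) : Fin.tail x ∈ S := by
  rw [← Fin.cons_self_tail x, outcomeProb_groverCircuit, hx] at h
  by_contra hS
  simp [hS] at h

/-- Ancilla `0` leaves exactly the unmarked strings, whose total weight is `cos² ((2t+1)θ)`. -/
lemma sum_outcomeProb_unverified {n : ℕ} (S : Finset (BitString n)) (t : ℕ) {θ : ℝ}
    (hθ : Real.sin θ ^ 2 = #S / 2 ^ n) :
    ∑ x, (if x 0 = false then
      Circuit.outcomeProb (fun x => decide (x ∈ S)) (groverCircuit n t) x else 0) =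
      1 - Real.sin ((2 * t + 1) * θ) ^ 2 := by
  have hN : (2 : ℝ) ^ n ≠ 0 := by positivity
  have h : ∀ z, (if false = decide (z ∈ S) then
      ‖twoValued S (groverAmp (#S / 2 ^ n) t) z‖ ^ 2 else 0) =
      if z ∈ S then 0 else (groverAmp (#S / 2 ^ n) t).2 ^ 2 / 2 ^ n := by
    intro z
    rw [norm_sq_twoValued]
    by_cases hz : z ∈ S <;> simp [hz]
  simp only [sum_bitString_succ, outcomeProb_groverCircuit, Fin.cons_zero, Fintype.sum_bool, h]
  have hc := (groverAmp_closed_form θ t).2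
  rw [hθ] at hc
  have hcos : Real.cos θ ^ 2 = 1 - #S / 2 ^ n := by rw [Real.cos_sq', hθ]
  have hs : (1 : ℝ) - Real.sin ((2 * t + 1) * θ) ^ 2 =
      ((groverAmp (#S / 2 ^ n) t).2 * Real.cos θ) ^ 2 := by
    rw [hc, ← Real.cos_sq', mul_pow, ← pow_mul, mul_comm t 2, pow_mul]
    simp
  rw [hs, mul_pow, hcos]
  simp only [if_true, Bool.true_eq_false, if_false, sum_const_zero, zero_add, sum_ite_mem_eq]
  field_simp
  ring

/-- Obtained from `sin² + cos² = 1` and the closed form, so unitarity of general circuits is not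
needed. -/
lemma sum_outcomeProb_groverCircuit {n : ℕ} (S : Finset (BitString n)) (t : ℕ) {θ : ℝ}
    (hθ : Real.sin θ ^ 2 = #S / 2 ^ n) :
    ∑ x, Circuit.outcomeProb (fun x => decide (x ∈ S)) (groverCircuit n t) x = 1 := by
  have hN : (2 : ℝ) ^ n ≠ 0 := by positivity
  simp only [sum_bitString_succ, outcomeProb_groverCircuit]
  rw [sum_comm]
  have h : ∀ z, ∑ b, (if b = decide (z ∈ S) then
      ‖twoValued S (groverAmp (#S / 2 ^ n) t) z‖ ^ 2 else 0) =
      if z ∈ S then (groverAmp (#S / 2 ^ n) t).1 ^ 2 / 2 ^ n else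
        (groverAmp (#S / 2 ^ n) t).2 ^ 2 / 2 ^ n := by
    intro z
    rw [sum_ite_eq' univ, norm_sq_twoValued]
    simp
  simp only [h, sum_ite_mem_eq]
  obtain ⟨h1, h2⟩ := groverAmp_closed_form θ t
  rw [hθ] at h1 h2
  have hcos : Real.cos θ ^ 2 = 1 - #S / 2 ^ n := by rw [Real.cos_sq', hθ]
  have hsign : (((-1 : ℝ)) ^ t) ^ 2 = 1 := by rw [← pow_mul, mul_comm t 2, pow_mul]; simp
  have hsum : ((groverAmp (#S / 2 ^ n) t).1 * Real.sin θ) ^ 2 +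
      ((groverAmp (#S / 2 ^ n) t).2 * Real.cos θ) ^ 2 = 1 := by
    rw [h1, h2, mul_pow, mul_pow, hsign, one_mul, one_mul, Real.sin_sq_add_cos_sq]
  rw [mul_pow, mul_pow, hθ, hcos] at hsum
  rw [← hsum]
  field_simp

/-! ### Parallel search -/

/-- The number of Grover iterations that each processor performs in a round. -/
noncomputable def iterations (n k M : ℕ) : ℕ := ⌊√((2 : ℝ) ^ n / (k * M)) / 4⌋₊

open Classical in
/-- In each of `40` rounds, every processor runs Grover's circuit on all `n`-bit strings and
verifies the result; some verified string is the output. -/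
noncomputable def parallelGrover (n k M : ℕ) : ParallelAlgorithm n k where
  Seed := Unit
  width := n + 1
  rounds := 40
  circuit _ _ _ := groverCircuit n (iterations n k M)
  output _ m :=
    if h : ∃ jr : Fin k × Fin 40, m jr.1 jr.2 0 = true then
      Fin.tail (m h.choose.1 h.choose.2) else fun _ => false

lemma sum_prod_prod {ι κ α : Type*} [Fintype ι] [Fintype κ] [Fintype α] [DecidableEq ι]
    [DecidableEq κ] (P : α → ℝ) :
    ∑ m : ι → κ → α, ∏ j, ∏ r, P (m j r) =
      (∑ x, P x) ^ (Fintype.card ι * Fintype.card κ) := by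
  rw [← Fintype.prod_sum (fun (_ : ι) (g : κ → α) => ∏ r, P (g r))]
  simp only [← Fintype.prod_sum (fun (_ : κ) (x : α) => P x), prod_const, card_univ]
  rw [← pow_mul, mul_comm]

/-- The left side is the total weight of all measurement records minus that of the records with
every ancilla `0`. Compared record by record: if a record of nonzero weight gives an output outside
`S`, no ancilla was `1`, since verified strings lie in `S`. -/
lemma le_successProb_parallelGrover {n k M : ℕ} (S : Finset (BitString n)) {θ : ℝ}
    (hθ : Real.sin θ ^ 2 = #S / 2 ^ n) :
    1 - (1 - Real.sin ((2 * iterations n k M + 1) * θ) ^ 2) ^ (k * 40) ≤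
      (parallelGrover n k M).successProb S := by
  set t := iterations n k M with ht
  set P := Circuit.outcomeProb (fun x => decide (x ∈ S)) (groverCircuit n t) with hP
  have hP0 : ∀ x, 0 ≤ P x := fun x => sq_nonneg _
  have h1 := sum_prod_prod (ι := Fin k) (κ := Fin 40) P
  have h2 := sum_prod_prod (ι := Fin k) (κ := Fin 40) fun x => if x 0 = false then P x else 0
  rw [hP, sum_outcomeProb_groverCircuit S t hθ, one_pow, ← hP] at h1
  rw [hP, sum_outcomeProb_unverified S t hθ, ← hP] at h2
  simp only [Fintype.card_fin] at h2
  refine le_of_eq_of_le (congrArg₂ (· - ·) h1.symm h2.symm) ?_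
  rw [← sum_sub_distrib]
  have hA : (parallelGrover n k M).successProb S =
      ∑ m : Fin k → Fin 40 → BitString (n + 1),
        if (parallelGrover n k M).output () m ∈ S then ∏ j, ∏ r, P (m j r) else 0 := by
    unfold ParallelAlgorithm.successProb
    have hc : Fintype.card (parallelGrover n k M).Seed = 1 := rfl
    rw [hc, Nat.cast_one, div_one]
    exact Fintype.sum_unique (ι := Unit) _
  rw [hA]
  refine sum_le_sum fun m _ => ?_
  have hnn : 0 ≤ ∏ j, ∏ r, P (m j r) := prod_nonneg fun j _ => prod_nonneg fun r _ => hP0 _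
  have hnn' : 0 ≤ ∏ j, ∏ r, (if m j r 0 = false then P (m j r) else 0) :=
    prod_nonneg fun j _ => prod_nonneg fun r _ => by split_ifs <;> [exact hP0 _; exact le_rfl]
  split_ifs with hout
  · linarith
  by_cases hz : ∏ j, ∏ r, P (m j r) = 0
  · rw [hz]; linarith
  have hne : ∀ j r, P (m j r) ≠ 0 := fun j r =>
    prod_ne_zero_iff.1 (prod_ne_zero_iff.1 hz j (mem_univ _)) r (mem_univ _)
  have hall : ∀ j r, m j r 0 = false := by
    by_contra! hex
    obtain ⟨j, r, hjr⟩ := hex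
    have h : ∃ jr : Fin k × Fin 40, m jr.1 jr.2 0 = true := ⟨(j, r), by simpa using hjr⟩
    refine hout ?_
    have ho : (parallelGrover n k M).output () m =
        Fin.tail (m h.choose.1 h.choose.2) := dif_pos h
    rw [ho]
    exact mem_of_outcomeProb_ne_zero (hne _ _) h.choose_spec
  simp [hall]

/-! ### Analysis of the parameters -/

lemma one_div_le_sin_sq {s p θ : ℝ} {k : ℕ} (hk : 1 ≤ k) (hs : 1 ≤ s) (hp : 0 < p)
    (hsp : s * p = (√(k : ℝ))⁻¹) (hsin : Real.sin θ = p) (h0 : 0 ≤ θ) (h1 : θ ≤ Real.pi / 2) :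
    1 / (40 * k : ℝ) ≤ Real.sin ((2 * (⌊s / 4⌋₊ : ℕ) + 1) * θ) ^ 2 := by
  have hk' : (1 : ℝ) ≤ k := by exact_mod_cast hk
  have hsk : 1 ≤ √(k : ℝ) := Real.one_le_sqrt.2 hk'
  have hsp1 : s * p ≤ 1 := hsp ▸ inv_le_one_of_one_le₀ hsk
  have hpi := Real.pi_pos
  have hθp : p ≤ θ := hsin ▸ Real.sin_le h0
  have hpθ : θ ≤ Real.pi / 2 * p := by
    have := Real.mul_le_sin h0 h1
    rw [hsin] at this
    rw [div_mul_eq_mul_div, div_le_iff₀ hpi] at this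
    linarith
  have hfl := Nat.floor_le (show 0 ≤ s / 4 by linarith)
  have hfl' := Nat.lt_floor_add_one (s / 4)
  set t := ⌊s / 4⌋₊
  have ht0 : (0 : ℝ) ≤ t := t.cast_nonneg
  have hup : (2 * (t : ℝ) + 1) * θ ≤ Real.pi / 2 := by
    -- Integrality matters: `4t ≤ s` yields `2t + 1 ≤ s` once `t ≥ 1`.
    rcases Nat.eq_zero_or_pos t with ht | ht
    · simpa [ht] using h1
    · have ht1 : (1 : ℝ) ≤ t := by exact_mod_cast ht
      calc (2 * (t : ℝ) + 1) * θ ≤ s * (Real.pi / 2 * p) := by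
            gcongr
            linarith
        _ = Real.pi / 2 * (s * p) := by ring
        _ ≤ Real.pi / 2 * 1 := by gcongr
        _ = Real.pi / 2 := mul_one _
  have hlow : (√(k : ℝ))⁻¹ / 4 ≤ (2 * (t : ℝ) + 1) * θ := by
    rw [← hsp]
    calc s * p / 4 = s / 4 * p := by ring
      _ ≤ (2 * (t : ℝ) + 1) * θ := by
        gcongr
        linarith
  have hpos : 0 ≤ (√(k : ℝ))⁻¹ / 4 := by positivity
  have hms := Real.mul_le_sin (hpos.trans hlow) hup
  have hb : 2 / Real.pi * ((√(k : ℝ))⁻¹ / 4) ≤ Real.sin ((2 * (t : ℝ) + 1) * θ) :=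
    le_trans (by gcongr) hms
  calc 1 / (40 * k : ℝ) ≤ 1 / (4 * Real.pi ^ 2 * k) := by
        -- Source of the constant `40 = 4 · 10`, which the number of rounds matches.
        have : Real.pi ^ 2 ≤ 10 := by nlinarith [Real.pi_lt_d2]
        gcongr
        linarith
    _ = (2 / Real.pi * ((√(k : ℝ))⁻¹ / 4)) ^ 2 := by
        have : √(k : ℝ) ^ 2 = k := Real.sq_sqrt (by linarith)
        rw [mul_pow, div_pow, div_pow, inv_pow, this]
        field_simp
        norm_num
    _ ≤ _ := by gcongr

lemma one_sub_pow_lt_half {q : ℝ} {k : ℕ} (hk : 1 ≤ k) (hq : 1 / (40 * k : ℝ) ≤ q) (hq1 : q ≤ 1) :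
    (1 - q) ^ (k * 40) < 1 / 2 := by
  have hk' : (1 : ℝ) ≤ k := by exact_mod_cast hk
  have hqk : 1 ≤ (k * 40 : ℕ) * q := by
    rw [div_le_iff₀ (by positivity)] at hq
    push_cast
    linarith
  calc (1 - q) ^ (k * 40) ≤ Real.exp (-q) ^ (k * 40) :=
        pow_le_pow_left₀ (by linarith) (Real.one_sub_le_exp_neg q) _
    _ = Real.exp (-((k * 40 : ℕ) * q)) := by rw [← Real.exp_nat_mul]; ring_nf
    _ ≤ Real.exp (-1) := Real.exp_le_exp.2 (by linarith)
    _ < 1 / 2 := by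
        rw [Real.exp_neg, inv_lt_comm₀ (Real.exp_pos 1) (by norm_num)]
        linarith [Real.exp_one_gt_d9]

lemma one_le_sqrt_ratio {n k M : ℕ} (hk : 1 ≤ k) (hM : 1 ≤ M) (h : k * M ≤ 2 ^ n) :
    1 ≤ √((2 : ℝ) ^ n / (k * M)) := by
  have hk' : (1 : ℝ) ≤ k := by exact_mod_cast hk
  have hM' : (1 : ℝ) ≤ M := by exact_mod_cast hM
  rw [Real.one_le_sqrt, one_le_div (by positivity)]
  exact_mod_cast h

lemma half_lt_successProb {n k M : ℕ} (hk : 1 ≤ k) (hM : 1 ≤ M) (h : k * M ≤ 2 ^ n)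
    {S : Finset (BitString n)} (hS : #S = M) :
    1 / 2 < (parallelGrover n k M).successProb S := by
  have hM' : (0 : ℝ) < M := by exact_mod_cast hM
  have hk' : (0 : ℝ) < k := by exact_mod_cast hk
  have hMN : (M : ℝ) / 2 ^ n ≤ 1 := by
    rw [div_le_one (by positivity)]
    exact_mod_cast (Nat.le_mul_of_pos_left M hk).trans h
  set p := √((M : ℝ) / 2 ^ n) with hp
  have hp0 : 0 < p := Real.sqrt_pos.2 (by positivity)
  have hp1 : p ≤ 1 := Real.sqrt_le_one.2 hMN
  have hsin : Real.sin (Real.arcsin p) = p := Real.sin_arcsin (by linarith) hp1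
  have hθ : Real.sin (Real.arcsin p) ^ 2 = #S / 2 ^ n := by
    rw [hsin, hp, Real.sq_sqrt (by positivity), hS]
  have hsp : √((2 : ℝ) ^ n / (k * M)) * p = (√(k : ℝ))⁻¹ := by
    rw [hp, ← Real.sqrt_mul (by positivity), ← Real.sqrt_inv]
    congr 1
    field_simp
  have hq := one_div_le_sin_sq hk (one_le_sqrt_ratio hk hM h) hp0 hsp hsin
    (Real.arcsin_nonneg.2 hp0.le) (Real.arcsin_le_pi_div_two p)
  have hlt := one_sub_pow_lt_half hk hq (Real.sin_sq_le_one _)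
  have hle := le_successProb_parallelGrover (k := k) (M := M) S hθ
  unfold iterations at hle
  linarith

lemma half_lt_avgSuccessProb {n k M : ℕ} (hk : 1 ≤ k) (hM : 1 ≤ M) (h : k * M ≤ 2 ^ n) :
    1 / 2 < (parallelGrover n k M).avgSuccessProb M := by
  have hMN : M ≤ 2 ^ n := (Nat.le_mul_of_pos_left M hk).trans h
  have hne : (powersetCard M (univ : Finset (BitString n))).Nonempty :=
    powersetCard_nonempty.2 (by simpa using hMN)
  rw [ParallelAlgorithm.avgSuccessProb, lt_div_iff₀ (by exact_mod_cast hne.card_pos), mul_comm,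
    ← nsmul_eq_mul, ← sum_const]
  exact sum_lt_sum_of_nonempty hne fun S hS =>
    half_lt_successProb hk hM h (mem_powersetCard.1 hS).2

lemma seqTime_parallelGrover_le (n k M : ℕ) :
    (parallelGrover n k M).seqTime ≤ 40 * (6 * iterations n k M + 3) := by
  refine Finset.sup_le fun ω _ => Finset.sup_le fun j _ => ?_
  refine (sum_le_card_nsmul univ _ (6 * iterations n k M + 3) fun r _ => ?_).trans_eq ?_
  · exact (congrArg (· + 1) (length_groverCircuit n (iterations n k M))).le
  · rw [card_univ, smul_eq_mul]
    exact congrArg (· * _) (Fintype.card_fin 40)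

lemma Circuit.queries_le_length {n w : ℕ} (c : Circuit n w) : c.queries ≤ c.length := by
  have h := List.sum_le_card_nsmul (c.map Layer.queries) 1 fun q hq => by
    obtain ⟨l, -, rfl⟩ := List.mem_map.1 hq
    cases l <;> simp [Layer.queries]
  simpa [Circuit.queries] using h

lemma ParallelAlgorithm.totalQueries_le {n k : ℕ} (A : ParallelAlgorithm n k) :
    A.totalQueries ≤ k * A.seqTime := by
  refine Finset.sup_le fun ω _ => ?_
  refine (sum_le_card_nsmul univ _ A.seqTime fun j _ => ?_).trans_eq (by simp)
  calc ∑ r, (A.circuit ω j r).queries ≤ ∑ r, ((A.circuit ω j r).length + 1) :=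
        sum_le_sum fun r _ => (Circuit.queries_le_length _).trans (Nat.le_succ _)
    _ ≤ univ.sup fun j : Fin k => ∑ r, ((A.circuit ω j r).length + 1) :=
        le_sup (f := fun j : Fin k => ∑ r, ((A.circuit ω j r).length + 1)) (mem_univ j)
    _ ≤ A.seqTime := le_sup (f := fun ω => univ.sup fun j : Fin k =>
        ∑ r, ((A.circuit ω j r).length + 1)) (mem_univ ω)

/-- With `s` the square root, `40(6t + 3) ≤ 60s + 120 ≤ 180s`; absorbing the constant needs `s ≥ 1`,
that is, `kM ≤ N`. -/
lemma seqTime_parallelGrover_le_sqrt {n k M : ℕ} (hk : 1 ≤ k) (hM : 1 ≤ M) (h : k * M ≤ 2 ^ n) :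
    ((parallelGrover n k M).seqTime : ℝ) ≤ 180 * √((2 : ℝ) ^ n / (k * M)) := by
  have hs := one_le_sqrt_ratio hk hM h
  have hfl : (iterations n k M : ℝ) ≤ √((2 : ℝ) ^ n / (k * M)) / 4 :=
    Nat.floor_le (by positivity)
  have hle : ((parallelGrover n k M).seqTime : ℝ) ≤ 40 * (6 * iterations n k M + 3) := by
    exact_mod_cast seqTime_parallelGrover_le n k M
  linarith

lemma mul_sqrt_ratio {N M : ℝ} {k : ℕ} (hk : 1 ≤ k) :
    (k : ℝ) * √(N / (k * M)) = √(k * N / M) := by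
  have hk' : (0 : ℝ) < k := by exact_mod_cast hk
  rw [show (k : ℝ) * N / M = k ^ 2 * (N / (k * M)) by field_simp, Real.sqrt_mul (by positivity),
    Real.sqrt_sq hk'.le]

end ParallelQuantum

theorem theorem1 :
    ∃ A : (n k M : ℕ) → ParallelQuantum.ParallelAlgorithm n k, ∃ C : ℝ, 0 < C ∧
      ∀ n k M : ℕ, 1 ≤ k → 1 ≤ M → k * M ≤ 2 ^ n →
        1 / 2 < (A n k M).avgSuccessProb M ∧
        ((A n k M).seqTime : ℝ) ≤ C * Real.sqrt ((2 : ℝ) ^ n / ((k : ℝ) * (M : ℝ))) ∧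
        ((A n k M).totalQueries : ℝ) ≤ C * Real.sqrt ((k : ℝ) * (2 : ℝ) ^ n / (M : ℝ)) := by
  refine ⟨ParallelQuantum.parallelGrover, 180, by norm_num, fun n k M hk hM h => ?_⟩
  have hseq := ParallelQuantum.seqTime_parallelGrover_le_sqrt hk hM h
  refine ⟨ParallelQuantum.half_lt_avgSuccessProb hk hM h, hseq, ?_⟩
  have hq : ((ParallelQuantum.parallelGrover n k M).totalQueries : ℝ) ≤
      k * (ParallelQuantum.parallelGrover n k M).seqTime := by
    exact_mod_cast ParallelQuantum.ParallelAlgorithm.totalQueries_le _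
  rw [← ParallelQuantum.mul_sqrt_ratio hk]
  calc _ ≤ _ := hq
    _ ≤ k * (180 * √((2 : ℝ) ^ n / (k * M))) := by gcongr
    _ = _ := by ring
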